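/- Call a topological space $X$ \emph{$\kappa$-compact} if every open cover of $X$ has a subcover of size less than $\kappa$, and let the \emph{weight} of $X$ be the least size of a base for its topology. An infinite cardinal $\kappa$ is \emph{$\lambda$-square compact} if for every $\kappa$-compact space $X$ of weight at most $\lambda$, the square $X^2$ (with the product topology) is $\kappa$-compact. An uncountable cardinal $\kappa$ is \emph{weakly compact} if $\kappa\to(\kappa)^2_2$, that is, every colouring of the two-element subsets of a set of size $\kappa$ with two colours has a homogeneous set of size $\kappa$. \textbf{Theorem.} Let $\kappa$ be an uncountable cardinal. Then $\kappa$ is weakly compact if and only if it is $\kappa$-square compact. This holds both when ``space'' means arbitrary topological space and when it means Hausdorff space. -/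

import Mathlib

open Cardinal

universe u

/-- A space `X` is `κ`-compact if every open cover of `X` has a subcover of size less than `κ`. -/
def KappaCompact (κ : Cardinal.{u}) (X : Type u) [TopologicalSpace X] : Prop :=
  ∀ U : Set (Set X), (∀ u ∈ U, IsOpen u) → ⋃₀ U = Set.univ →
    ∃ V : Set (Set X), V ⊆ U ∧ #V < κ ∧ ⋃₀ V = Set.univ

/-- The weight of a space: the least size of a base for its topology. -/
noncomputable def topWeight (X : Type u) [TopologicalSpace X] : Cardinal.{u} :=
  sInf {c : Cardinal.{u} | ∃ B : Set (Set X), TopologicalSpace.IsTopologicalBasis B ∧ #B = c}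

/-- An infinite cardinal `κ` is `μ`-square compact if for every space `X` of weight at most `μ`,
if `X` is `κ`-compact, then so is `X²`. -/
def SquareCompact (μ κ : Cardinal.{u}) : Prop :=
  ℵ₀ ≤ κ ∧ ∀ (X : Type u) [TopologicalSpace X],
    topWeight X ≤ μ → KappaCompact κ X → KappaCompact κ (X × X)

/-- `μ`-square compactness under the convention that all spaces are Hausdorff. -/
def SquareCompactT2 (μ κ : Cardinal.{u}) : Prop :=
  ℵ₀ ≤ κ ∧ ∀ (X : Type u) [TopologicalSpace X] [T2Space X],
    topWeight X ≤ μ → KappaCompact κ X → KappaCompact κ (X × X)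

/-- A cardinal `κ` is weakly compact if it is uncountable and satisfies the partition relation
`κ → (κ)²₂`: every 2-colouring of the two-element subsets of a set of size `κ` has a homogeneous
set of size `κ`. -/
def WeaklyCompact (κ : Cardinal.{u}) : Prop :=
  ℵ₀ < κ ∧ ∀ A : Type u, #A = κ → ∀ c : {s : Finset A // s.card = 2} → Bool,
    ∃ H : Set A, #H = κ ∧ ∃ b : Bool, ∀ s : {s : Finset A // s.card = 2},
      (s.1 : Set A) ⊆ H → c s = b

/-! Weakly compact implies square compact, for arbitrary spaces. If a cover of `X²` has no small
subcover, enumerate in order type `κ` the basic boxes lying inside members of the cover and pick `z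
α` outside the members chosen for the first boxes, up to `α`. The partition relation thins `z` to
`κ` many indices along which membership in each basic open set is eventually constant
(`RegularOrder.exists_eventually_decided`). By `κ`-compactness both coordinates then converge, and a
basic box around the limit pair gives a contradiction.

The converse needs only Hausdorff spaces. Three times, a failure of some property of `κ` yields a
`κ`-compact Hausdorff space of weight at most `κ` whose square has a closed discrete subset of size
`κ`. A failure of regularity gives a one-limit-point space. Failures of the strong limit property
and of the branch property give linear orders of size `κ` with the topology of half-open intervals
`[x, y)`: as for the Sorgenfrey line, the graph of an order-reversing involution is closed and
discrete in the square. These orders consist of lexicographically ordered binary sequences, and the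
involution flips all bits. A branch through the tree of colour patterns finally gives a homogeneous
set. -/

/-- A linear order of cardinality `κ` whose proper initial segments have size less than `κ`, and in
which every family of fewer than `κ` elements is bounded. -/
structure RegularOrder (κ : Cardinal.{u}) (W : Type u) [LinearOrder W] : Prop where
  card : #W = κ
  card_Iic_lt : ∀ a : W, #(Set.Iic a) < κ
  bdd : ∀ {ι : Type u} (f : ι → W), #ι < κ → ∃ a, ∀ i, f i ≤ a

/-! ### Well-orders of type `κ` and regularity -/

theorem exists_initial_wellOrder (A : Type u) (h : ℵ₀ ≤ #A) :
    ∃ (_ : LinearOrder A) (_ : WellFoundedLT A), ∀ a : A, #(Set.Iic a) < #A := by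
  obtain ⟨i, w, e⟩ := exists_ord_eq_type_lt A
  refine ⟨i, w, fun a => ?_⟩
  have h1 := mk_Iio_lt a e
  rw [← Set.Iio_insert]
  exact mk_insert_le.trans_lt (add_lt_of_lt h h1 (one_lt_aleph0.trans_le h))

theorem exists_gt_of_mk_eq {κ : Cardinal.{u}} {W : Type u} [LinearOrder W]
    (hI : ∀ a : W, #(Set.Iic a) < κ) {H : Set W} (hH : #H = κ) (a : W) : ∃ b ∈ H, a < b := by
  by_contra! hc
  exact ((mk_le_mk_of_subset (show H ⊆ Set.Iic a from hc)).trans_lt (hI a)).ne hH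

theorem RegularOrder.mk_eq_of_unbounded {κ : Cardinal.{u}} {W : Type u} [LinearOrder W]
    (hW : RegularOrder κ W) {H : Set W} (hH : ∀ a, ∃ b ∈ H, a < b) : #H = κ := by
  refine le_antisymm ((mk_set_le H).trans hW.card.le) ?_
  by_contra! hc
  obtain ⟨a, ha⟩ := hW.bdd (fun x : H => x.1) hc
  obtain ⟨b, hb, hab⟩ := hH a
  exact (ha ⟨b, hb⟩).not_gt hab

/-- If `W` embedded in the union, each `V i` would account for a bounded part of `W`, and the fewer
than `κ` bounds would have a common bound. -/
theorem RegularOrder.mk_iUnion_lt {κ : Cardinal.{u}} {W : Type u} [LinearOrder W]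
    (hW : RegularOrder κ W) {ι α : Type u} (hι : #ι < κ) (V : ι → Set α) (hV : ∀ i, #(V i) < κ) :
    #(⋃ i, V i : Set α) < κ := by
  by_contra! hc
  rw [← hW.card] at hc
  obtain ⟨e⟩ := hc
  have hbd : ∀ i, ∃ a, ∀ w, (e w : α) ∈ V i → w ≤ a := by
    intro i
    have hlt : #{w // (e w : α) ∈ V i} < κ := by
      refine lt_of_le_of_lt (mk_le_of_injective
        (f := fun w : {w // (e w : α) ∈ V i} => (⟨e w.1, w.2⟩ : V i)) ?_) (hV i)
      intro x y h
      exact Subtype.ext (e.injective (Subtype.ext (congrArg (fun z : V i => z.1) h)))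
    obtain ⟨a, ha⟩ := hW.bdd (fun w : {w // (e w : α) ∈ V i} => w.1) hlt
    exact ⟨a, fun w hw => ha ⟨w, hw⟩⟩
  choose a ha using hbd
  obtain ⟨m, hm⟩ := hW.bdd a hι
  have hall : (Set.univ : Set W) ⊆ Set.Iic m := by
    intro w _
    obtain ⟨i, hi⟩ := Set.mem_iUnion.1 (e w).2
    exact (ha i w hi).trans (hm i)
  have := (mk_le_mk_of_subset hall).trans_lt (hW.card_Iic_lt m)
  rw [mk_univ, hW.card] at this
  exact lt_irrefl _ this

/-! ### From the partition relation to square compactness -/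

theorem WeaklyCompact.exists_homogeneous {κ : Cardinal.{u}} (h : WeaklyCompact κ) {W : Type u}
    [LinearOrder W] (hW : #W = κ) (R : W → W → Prop) :
    ∃ H : Set W, #H = κ ∧ ((∀ x ∈ H, ∀ y ∈ H, x < y → R x y) ∨
      (∀ x ∈ H, ∀ y ∈ H, x < y → ¬ R x y)) := by
  classical
  obtain ⟨H, hH, b, hb⟩ := h.2 W hW
    (fun s => decide (∃ x y, x < y ∧ s.1 = {x, y} ∧ R x y))
  refine ⟨H, hH, ?_⟩
  have key : ∀ x ∈ H, ∀ y ∈ H, x < y → (R x y ↔ b = true) := by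
    intro x hx y hy hxy
    have := hb ⟨{x, y}, Finset.card_pair hxy.ne⟩ (by
      simp [Set.insert_subset_iff, hx, hy])
    rw [← this, decide_eq_true_iff]
    constructor
    · exact fun hr => ⟨x, y, hxy, rfl, hr⟩
    · rintro ⟨x', y', hxy', he, hr⟩
      have he' : ({x, y} : Set W) = {x', y'} := by
        have := congrArg (fun s : Finset W => (s : Set W)) he
        simpa using this
      rcases Set.pair_eq_pair_iff.1 he' with ⟨rfl, rfl⟩ | ⟨rfl, rfl⟩
      · exact hr
      · exact absurd hxy hxy'.not_gt
  cases b
  · exact Or.inr fun x hx y hy hxy hr => by simpa using (key x hx y hy hxy).1 hr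
  · exact Or.inl fun x hx y hy hxy => (key x hx y hy hxy).2 rfl

/-- If `f` is unbounded, send `x` to an index `p x` with `x < f (p x)` and colour pairs by whether
`p` agrees on them. On a homogeneous set `p` is either constant, which bounds the set, or injective,
which makes `ι` too large. -/
theorem WeaklyCompact.regularOrder {κ : Cardinal.{u}} (h : WeaklyCompact κ) {W : Type u}
    [LinearOrder W] (hW : #W = κ) (hI : ∀ a : W, #(Set.Iic a) < κ) : RegularOrder κ W := by
  refine ⟨hW, hI, fun {ι} f hι => ?_⟩
  by_contra! hc
  choose p hp using hc
  obtain ⟨H, hH, h1 | h1⟩ := h.exists_homogeneous hW (fun x y => p x = p y)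
  · have hne : Nonempty H := by
      rw [← mk_ne_zero_iff, hH]
      exact (aleph0_pos.trans h.1).ne'
    obtain ⟨x, hx⟩ := hne
    obtain ⟨b, hb, hxb⟩ := exists_gt_of_mk_eq hI hH (max x (f (p x)))
    have := h1 x hx b hb ((le_max_left _ _).trans_lt hxb)
    have h2 := hp b
    rw [← this] at h2
    exact (((le_max_right _ _).trans_lt hxb).trans h2).false
  · refine (mk_le_of_injective (f := fun x : H => p x.1) ?_).not_gt (hH ▸ hι)
    intro x y hxy
    rcases lt_trichotomy x.1 y.1 with hlt | heq | hlt
    · exact absurd hxy (h1 _ x.2 _ y.2 hlt)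
    · exact Subtype.ext heq
    · exact absurd hxy.symm (h1 _ y.2 _ x.2 hlt)

theorem RegularOrder.exists_eventually_decided {κ : Cardinal.{u}} (h : WeaklyCompact κ) {W : Type u}
    [LinearOrder W] [WellFoundedLT W] (hW : RegularOrder κ W) (S : W → Set W) :
    ∃ H : Set W, #H = κ ∧ ∀ ξ, ∃ a, (∀ β ∈ H, a ≤ β → β ∈ S ξ) ∨ (∀ β ∈ H, a ≤ β → β ∉ S ξ) := by
  -- The relation says that the membership sequence of `x` is lexicographically at most that of `y`,
  -- so these sequences are monotone along `H`. Once the coordinates below `ξ` have stabilised,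
  -- coordinate `ξ` is itself monotone and changes at most once.
  obtain ⟨H, hH, hR⟩ := h.exists_homogeneous hW.card
    (fun x y => ∀ ξ, (∀ η < ξ, (x ∈ S η ↔ y ∈ S η)) → x ∈ S ξ → y ∈ S ξ)
  refine ⟨H, hH, fun ξ => ?_⟩
  induction ξ using WellFoundedLT.induction with
  | ind ξ ih =>
    choose! a ha using ih
    obtain ⟨m, hm⟩ := hW.bdd (fun η : Set.Iio ξ => a η.1)
      ((mk_le_mk_of_subset Set.Iio_subset_Iic_self).trans_lt (hW.card_Iic_lt ξ))
    have hag : ∀ x ∈ H, ∀ y ∈ H, m ≤ x → m ≤ y → ∀ η < ξ, (x ∈ S η ↔ y ∈ S η) := by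
      intro x hx y hy hmx hmy η hη
      have hma := hm ⟨η, hη⟩
      rcases ha η hη with h1 | h1
      · exact iff_of_true (h1 x hx (hma.trans hmx)) (h1 y hy (hma.trans hmy))
      · exact iff_of_false (h1 x hx (hma.trans hmx)) (h1 y hy (hma.trans hmy))
    rcases hR with hR | hR
    · by_cases hex : ∃ β ∈ H, m ≤ β ∧ β ∈ S ξ
      · obtain ⟨β, hβ, hmβ, hβS⟩ := hex
        refine ⟨β, Or.inl fun γ hγ hle => ?_⟩
        rcases hle.eq_or_lt with rfl | hlt
        · exact hβS
        · exact hR β hβ γ hγ hlt ξ (hag β hβ γ hγ hmβ (hmβ.trans hle)) hβS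
      · push Not at hex
        exact ⟨m, Or.inr hex⟩
    · by_cases hex : ∃ β ∈ H, m ≤ β ∧ β ∉ S ξ
      · obtain ⟨β, hβ, hmβ, hβS⟩ := hex
        refine ⟨β, Or.inr fun γ hγ hle => ?_⟩
        rcases hle.eq_or_lt with rfl | hlt
        · exact hβS
        · intro hγS
          have := hR β hβ γ hγ hlt
          push Not at this
          obtain ⟨ζ, hζ, hz1, hz2⟩ := this
          rcases lt_trichotomy ζ ξ with hlt' | rfl | hlt'
          · exact hz2 ((hag β hβ γ hγ hmβ (hmβ.trans hle) ζ hlt').1 hz1)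
          · exact hz2 hγS
          · exact hβS ((hζ ξ hlt').2 hγS)
      · push Not at hex
        exact ⟨m, Or.inl hex⟩

theorem RegularOrder.exists_eventually_decided_of_mk_le {κ : Cardinal.{u}} (h : WeaklyCompact κ)
    {W : Type u} [LinearOrder W] [WellFoundedLT W] (hW : RegularOrder κ W) {I : Type u}
    (hI : #I ≤ κ) (S : I → Set W) :
    ∃ H : Set W, #H = κ ∧ ∀ i, ∃ a, (∀ β ∈ H, a ≤ β → β ∈ S i) ∨ (∀ β ∈ H, a ≤ β → β ∉ S i) := by
  rw [← hW.card] at hI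
  obtain ⟨e⟩ := hI
  obtain ⟨H, hH, hd⟩ := hW.exists_eventually_decided h (fun w => {β | ∃ i, e i = w ∧ β ∈ S i})
  refine ⟨H, hH, fun i => ?_⟩
  simpa using hd (e i)

/-- Otherwise every point has a basic neighbourhood that the sequence eventually avoids; fewer than
`κ` of these cover `X`, and beyond a common threshold the sequence has nowhere to be. -/
theorem KappaCompact.exists_limit {κ : Cardinal.{u}} {W : Type u} [LinearOrder W]
    (hW : RegularOrder κ W) {X : Type u} [TopologicalSpace X] (hX : KappaCompact κ X)
    {B : Set (Set X)} (hB : TopologicalSpace.IsTopologicalBasis B) (x : W → X) {H : Set W}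
    (hH : #H = κ)
    (hd : ∀ b ∈ B, ∃ a, (∀ β ∈ H, a ≤ β → x β ∈ b) ∨ (∀ β ∈ H, a ≤ β → x β ∉ b)) :
    ∃ p, ∀ b ∈ B, p ∈ b → ∃ a, ∀ β ∈ H, a ≤ β → x β ∈ b := by
  by_contra! hc
  obtain ⟨V, hVU, hV, hVc⟩ := hX {b | b ∈ B ∧ ∃ a, ∀ β ∈ H, a ≤ β → x β ∉ b}
    (fun u hu => hB.isOpen hu.1) (by
      refine Set.eq_univ_of_forall fun p => ?_
      obtain ⟨b, hb, hpb, hn⟩ := hc p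
      obtain ⟨a, ha | ha⟩ := hd b hb
      · obtain ⟨β, hβ, hle, hnb⟩ := hn a
        exact absurd (ha β hβ hle) hnb
      · exact ⟨b, ⟨hb, a, ha⟩, hpb⟩)
  choose a ha using fun v : V => (hVU v.2).2
  obtain ⟨m, hm⟩ := hW.bdd a hV
  obtain ⟨β, hβ, hmβ⟩ := exists_gt_of_mk_eq hW.card_Iic_lt hH m
  have : x β ∈ ⋃₀ V := hVc ▸ Set.mem_univ _
  obtain ⟨v, hv, hxv⟩ := this
  exact ha ⟨v, hv⟩ β hβ ((hm ⟨v, hv⟩).trans hmβ.le) hxv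

theorem exists_basis_mk_eq_topWeight (X : Type u) [TopologicalSpace X] :
    ∃ B : Set (Set X), TopologicalSpace.IsTopologicalBasis B ∧ #B = topWeight X :=
  csInf_mem (s := {c : Cardinal.{u} | ∃ B : Set (Set X),
    TopologicalSpace.IsTopologicalBasis B ∧ #B = c})
    ⟨_, _, TopologicalSpace.isTopologicalBasis_opens, rfl⟩

theorem topWeight_le {X : Type u} [TopologicalSpace X] {B : Set (Set X)}
    (hB : TopologicalSpace.IsTopologicalBasis B) : topWeight X ≤ #B :=
  csInf_le' ⟨B, hB, rfl⟩

theorem WeaklyCompact.squareCompact {κ : Cardinal.{u}} (h : WeaklyCompact κ) :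
    SquareCompact κ κ := by
  refine ⟨h.1.le, fun X _ hw hX U hUo hUc => ?_⟩
  obtain ⟨_, _, hI⟩ := exists_initial_wellOrder κ.out (by rw [mk_out]; exact h.1.le)
  have hW := h.regularOrder (mk_out κ) (by simpa using hI)
  obtain ⟨B, hB, hBw⟩ := exists_basis_mk_eq_topWeight X
  rw [← hBw] at hw
  have hBB : #(B × B) ≤ #κ.out := by
    rw [mk_prod, lift_id, mk_out]
    exact (mul_le_mul' hw hw).trans (mul_eq_self h.1.le).le
  obtain ⟨r⟩ := hBB
  by_contra! hc
  let Good : B × B → Prop := fun p => ∃ u ∈ U, p.1.1 ×ˢ p.2.1 ⊆ u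
  choose! u huU hu using fun (p : B × B) (hp : Good p) => hp
  -- Only fewer than `κ` boxes have index at most `α`, so their chosen members do not cover the
  -- square.
  have hz : ∀ α : κ.out, ∃ z : X × X, ∀ p, Good p → r p ≤ α → z ∉ u p := by
    intro α
    by_contra! hcov
    refine hc (Set.range fun p : {p // Good p ∧ r p ≤ α} => u p.1) ?_ ?_ ?_
    · rintro _ ⟨p, rfl⟩
      exact huU p.1 p.2.1
    · refine mk_range_le.trans_lt (lt_of_le_of_lt (mk_le_of_injective
        (f := fun p : {p // Good p ∧ r p ≤ α} => (⟨r p.1, p.2.2⟩ : Set.Iic α)) ?_)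
          (hW.card_Iic_lt α))
      intro p q hpq
      exact Subtype.ext (r.injective (congrArg Subtype.val hpq))
    · refine Set.eq_univ_of_forall fun z => ?_
      obtain ⟨p, hp, hpα, hzp⟩ := hcov z
      exact ⟨u p, ⟨⟨p, hp, hpα⟩, rfl⟩, hzp⟩
  choose z hz using hz
  obtain ⟨H, hH, hd⟩ := hW.exists_eventually_decided_of_mk_le h (I := B ⊕ B) (by
      rw [mk_sum, lift_id]
      exact (add_le_add hw hw).trans (add_eq_self h.1.le).le)
    (Sum.elim (fun b => {α | (z α).1 ∈ b.1}) (fun b => {α | (z α).2 ∈ b.1}))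
  obtain ⟨p, hp⟩ := hX.exists_limit hW hB (fun α => (z α).1) hH
    (fun b hb => by simpa using hd (Sum.inl ⟨b, hb⟩))
  obtain ⟨q, hq⟩ := hX.exists_limit hW hB (fun α => (z α).2) hH
    (fun b hb => by simpa using hd (Sum.inr ⟨b, hb⟩))
  have hpq : (p, q) ∈ ⋃₀ U := hUc ▸ Set.mem_univ _
  obtain ⟨v, hvU, hv⟩ := hpq
  obtain ⟨b, ⟨b1, hb1, b2, hb2, rfl⟩, hpqb, hbv⟩ :=
    (hB.prod hB).exists_subset_of_mem_open hv (hUo v hvU)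
  have hg : Good (⟨b1, hb1⟩, ⟨b2, hb2⟩) := ⟨v, hvU, hbv⟩
  obtain ⟨a1, ha1⟩ := hp b1 hb1 hpqb.1
  obtain ⟨a2, ha2⟩ := hq b2 hb2 hpqb.2
  obtain ⟨β, hβ, hlt⟩ := exists_gt_of_mk_eq hW.card_Iic_lt hH
    (max (max a1 a2) (r (⟨b1, hb1⟩, ⟨b2, hb2⟩)))
  simp only [max_lt_iff] at hlt
  exact hz β _ hg hlt.2.le (hu _ hg ⟨ha1 β hβ hlt.1.1.le, ha2 β hβ hlt.1.2.le⟩)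

/-! ### Regularity from square compactness -/

/-- The topology on `ι ⊕ W` with a point added, where all points but the added one are isolated and
the added one has the final segments of `W` as neighbourhoods. -/
abbrev finalSegmentTopology (ι W : Type u) [LinearOrder W] [Nonempty W] :
    TopologicalSpace (Option (ι ⊕ W)) where
  IsOpen U := none ∈ U → ∃ a : W, ∀ w, a < w → some (Sum.inr w) ∈ U
  isOpen_univ := fun _ => ⟨Classical.arbitrary W, fun _ _ => trivial⟩
  isOpen_inter := fun U V hU hV h => by
    obtain ⟨a, ha⟩ := hU h.1
    obtain ⟨b, hb⟩ := hV h.2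
    exact ⟨max a b, fun w hw => ⟨ha w ((le_max_left _ _).trans_lt hw),
      hb w ((le_max_right _ _).trans_lt hw)⟩⟩
  isOpen_sUnion := fun S hS ⟨U, hU, hn⟩ => by
    obtain ⟨a, ha⟩ := hS U hU hn
    exact ⟨a, fun w hw => ⟨U, hU, ha w hw⟩⟩

theorem topWeight_finalSegmentTopology_le (ι W : Type u) [LinearOrder W] [Nonempty W] :
    @topWeight _ (finalSegmentTopology ι W) ≤ #((ι ⊕ W) ⊕ W) := by
  let _ := finalSegmentTopology ι W
  refine (topWeight_le (B := Set.range (Sum.elim (fun s : ι ⊕ W => ({some s} : Set (Option (ι ⊕ W))))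
    (fun a : W => {p | ∀ s, p = some s → ∃ w, a < w ∧ s = Sum.inr w}))) ?_).trans mk_range_le
  refine TopologicalSpace.isTopologicalBasis_of_isOpen_of_nhds ?_ ?_
  · rintro _ ⟨s | a, rfl⟩
    · intro h
      simp at h
    · intro _
      exact ⟨a, fun w hw s hs => ⟨w, hw, (Option.some.inj hs).symm⟩⟩
  · rintro (_ | s) U hp hU
    · obtain ⟨a, ha⟩ := hU hp
      refine ⟨_, ⟨Sum.inr a, rfl⟩, fun s hs => by simp at hs, ?_⟩
      rintro (_ | s) hs
      · exact hp
      · obtain ⟨w, hw, rfl⟩ := hs s rfl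
        exact ha w hw
    · exact ⟨_, ⟨Sum.inl s, rfl⟩, rfl, by simpa using hp⟩

theorem t2Space_finalSegmentTopology (ι W : Type u) [LinearOrder W] [Nonempty W] :
    @T2Space _ (finalSegmentTopology ι W) := by
  let _ := finalSegmentTopology ι W
  have hs : ∀ s : ι ⊕ W, IsOpen ({some s} : Set (Option (ι ⊕ W))) := by
    intro s h
    simp at h
  have hc : ∀ s : ι ⊕ W, IsOpen ({some s}ᶜ : Set (Option (ι ⊕ W))) := by
    rintro (i | w) _
    · exact ⟨Classical.arbitrary W, fun w _ => by simp⟩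
    · exact ⟨w, fun v hv => by simp [hv.ne']⟩
  refine ⟨?_⟩
  rintro (_ | s) y hxy
  · obtain ⟨s, rfl⟩ := Option.ne_none_iff_exists'.1 hxy.symm
    exact ⟨_, _, hc s, hs s, hxy, rfl, disjoint_compl_left⟩
  · exact ⟨_, _, hs s, hc s, rfl, hxy.symm, disjoint_compl_right⟩

/-- One member around the added point swallows a final segment of `W`; fewer than `κ` points remain.
-/
theorem kappaCompact_finalSegmentTopology {κ : Cardinal.{u}} (hκ : ℵ₀ ≤ κ) {ι W : Type u}
    [LinearOrder W] [Nonempty W] (hI : ∀ a : W, #(Set.Iic a) < κ) (hι : #ι < κ) :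
    @KappaCompact κ _ (finalSegmentTopology ι W) := by
  let _ := finalSegmentTopology ι W
  intro U hUo hUc
  have hcov : ∀ p, ∃ u ∈ U, p ∈ u := fun p => (hUc ▸ Set.mem_univ p : p ∈ ⋃₀ U)
  choose u hu hpu using hcov
  obtain ⟨a, ha⟩ := hUo _ (hu none) (hpu none)
  refine ⟨insert (u none) (Set.range (Sum.elim (fun i : ι => u (some (Sum.inl i)))
    (fun w : Set.Iic a => u (some (Sum.inr w.1))))), ?_, ?_, ?_⟩
  · rintro _ (rfl | ⟨i | w, rfl⟩)
    exacts [hu _, hu _, hu _]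
  · refine mk_insert_le.trans_lt (add_lt_of_lt hκ (mk_range_le.trans_lt ?_)
      (one_lt_aleph0.trans_le hκ))
    rw [mk_sum, lift_id, lift_id]
    exact add_lt_of_lt hκ hι (hI a)
  · refine Set.eq_univ_of_forall ?_
    rintro (_ | i | w)
    · exact ⟨_, Or.inl rfl, hpu _⟩
    · exact ⟨_, Or.inr ⟨Sum.inl i, rfl⟩, hpu _⟩
    · rcases le_or_gt w a with h | h
      · exact ⟨_, Or.inr ⟨Sum.inr ⟨w, h⟩, rfl⟩, hpu _⟩
      · exact ⟨_, Or.inl rfl, ha w h⟩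

theorem SquareCompactT2.regularOrder {κ : Cardinal.{u}} (h : SquareCompactT2 κ κ) {W : Type u}
    [LinearOrder W] (hW : #W = κ) (hI : ∀ a : W, #(Set.Iic a) < κ) : RegularOrder κ W := by
  refine ⟨hW, hI, fun {ι} f hι => ?_⟩
  by_contra! hc
  have hne : Nonempty W := by
    rw [← mk_ne_zero_iff, hW]
    exact (aleph0_pos.trans_le h.1).ne'
  let _ := finalSegmentTopology ι W
  have := t2Space_finalSegmentTopology ι W
  have hw : topWeight (Option (ι ⊕ W)) ≤ κ := by
    refine (topWeight_finalSegmentTopology_le ι W).trans ?_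
    simp only [mk_sum, lift_id, hW]
    exact add_le_of_le h.1 (add_le_of_le h.1 hι.le le_rfl) le_rfl
  have hsq := h.2 _ hw (kappaCompact_finalSegmentTopology h.1 hI hι)
  have hs : ∀ s : ι ⊕ W, IsOpen ({some s} : Set (Option (ι ⊕ W))) := by
    intro s h
    simp at h
  choose g hg using hc
  -- The points `(g w, w)` form a closed discrete set of size `κ`. The column over `i` minus this
  -- set is open because the fibre of `g` over `i` is bounded by `f i`.
  refine absurd (hsq
    (Set.range (fun w : W => ({(some (Sum.inl (g w)), some (Sum.inr w))} : Set _)) ∪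
      (Set.range (fun i : ι => ({some (Sum.inl i)} : Set (Option (ι ⊕ W))) ×ˢ
          {p | ∀ w, p = some (Sum.inr w) → g w ≠ i}) ∪
      {{p | ∀ i, p ≠ some (Sum.inl i)} ×ˢ Set.univ})) ?_ ?_) ?_
  · rintro v (⟨w, rfl⟩ | ⟨i, rfl⟩ | rfl)
    · dsimp only
      rw [← Set.singleton_prod_singleton]
      exact (hs _).prod (hs _)
    · refine (hs _).prod fun _ => ⟨f i, fun w hw w' hw' => ?_⟩
      cases hw'
      rintro rfl
      exact (hg w).not_gt hw
    · refine IsOpen.prod (fun _ => ?_) isOpen_univ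
      exact ⟨Classical.arbitrary W, fun w _ i => by simp⟩
  · refine Set.eq_univ_of_forall ?_
    rintro ⟨p, q⟩
    by_cases hp : ∀ i, p ≠ some (Sum.inl i)
    · exact ⟨_, Or.inr (Or.inr rfl), hp, trivial⟩
    · push Not at hp
      obtain ⟨i, rfl⟩ := hp
      by_cases hq : ∀ w, q = some (Sum.inr w) → g w ≠ i
      · exact ⟨_, Or.inr (Or.inl ⟨i, rfl⟩), rfl, hq⟩
      · push Not at hq
        obtain ⟨w, rfl, rfl⟩ := hq
        exact ⟨_, Or.inl ⟨w, rfl⟩, rfl⟩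
  · rintro ⟨V, hVU, hV, hVc⟩
    have hmem : ∀ w, ({(some (Sum.inl (g w)), some (Sum.inr w))} : Set _) ∈ V := by
      intro w
      have : (some (Sum.inl (g w)), some (Sum.inr w)) ∈ ⋃₀ V := hVc ▸ Set.mem_univ _
      obtain ⟨v, hv, hmv⟩ := this
      rcases hVU hv with ⟨w', rfl⟩ | ⟨i, rfl⟩ | rfl
      · simp only [Set.mem_singleton_iff, Prod.mk.injEq, Option.some.injEq, Sum.inr.injEq] at hmv
        rw [hmv.2]
        exact hv
      · have h1 := hmv.1
        simp only [Set.mem_singleton_iff, Option.some.injEq, Sum.inl.injEq] at h1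
        exact absurd h1 (hmv.2 w rfl)
      · exact absurd rfl (hmv.1 (g w))
    have : #W ≤ #V := by
      refine mk_le_of_injective (f := fun w => (⟨_, hmem w⟩ : V)) fun w w' hww => ?_
      have := congrArg Subtype.val hww
      simp only [Set.singleton_eq_singleton_iff, Prod.mk.injEq, Option.some.injEq,
        Sum.inr.injEq] at this
      exact this.2
    exact (this.trans_lt hV).ne hW

/-! ### Half-open interval topologies and the antidiagonal -/

/-- The topology on a linear order generated by the half-open intervals `[x, y)`. -/
abbrev rightTopology (L : Type u) [LinearOrder L] : TopologicalSpace L where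
  IsOpen U := ∀ x ∈ U, ∃ c : WithTop L, (x : WithTop L) < c ∧
    ∀ y, x ≤ y → (y : WithTop L) < c → y ∈ U
  isOpen_univ := fun x _ => ⟨⊤, WithTop.coe_lt_top x, fun _ _ _ => trivial⟩
  isOpen_inter := fun U V hU hV x hx => by
    obtain ⟨a, hxa, ha⟩ := hU x hx.1
    obtain ⟨b, hxb, hb⟩ := hV x hx.2
    exact ⟨min a b, lt_min hxa hxb, fun y hy hyc => ⟨ha y hy (hyc.trans_le (min_le_left _ _)),
      hb y hy (hyc.trans_le (min_le_right _ _))⟩⟩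
  isOpen_sUnion := fun S hS x ⟨U, hU, hn⟩ => by
    obtain ⟨a, hxa, ha⟩ := hS U hU x hn
    exact ⟨a, hxa, fun y hy hya => ⟨U, hU, ha y hy hya⟩⟩

theorem isOpen_rightTopology {L : Type u} [LinearOrder L] (x : L) (c : WithTop L) :
    @IsOpen L (rightTopology L) {y | x ≤ y ∧ (y : WithTop L) < c} :=
  fun _ hy => ⟨c, hy.2, fun _ hz hzc => ⟨hy.1.trans hz, hzc⟩⟩

theorem isOpen_rightTopology_Ici {L : Type u} [LinearOrder L] (x : L) :
    @IsOpen L (rightTopology L) (Set.Ici x) :=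
  fun y hy => ⟨⊤, WithTop.coe_lt_top y, fun _ hz _ => le_trans hy hz⟩

theorem isOpen_rightTopology_Ico {L : Type u} [LinearOrder L] (x c : L) :
    @IsOpen L (rightTopology L) (Set.Ico x c) :=
  fun _ hy => ⟨c, WithTop.coe_lt_coe.2 hy.2, fun _ hz hzc =>
    ⟨hy.1.trans hz, WithTop.coe_lt_coe.1 hzc⟩⟩

theorem topWeight_rightTopology_le (L : Type u) [LinearOrder L] :
    @topWeight _ (rightTopology L) ≤ #(L × WithTop L) := by
  let _ := rightTopology L
  refine (topWeight_le (B := Set.range fun p : L × WithTop L => {y | p.1 ≤ y ∧ (y : WithTop L) < p.2})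
    ?_).trans mk_range_le
  refine TopologicalSpace.isTopologicalBasis_of_isOpen_of_nhds ?_ ?_
  · rintro _ ⟨p, rfl⟩
    exact isOpen_rightTopology _ _
  · intro x U hx hU
    obtain ⟨c, hc, h⟩ := hU x hx
    exact ⟨_, ⟨(x, c), rfl⟩, ⟨le_rfl, hc⟩, fun y hy => h y hy.1 hy.2⟩

theorem t2Space_rightTopology (L : Type u) [LinearOrder L] : @T2Space _ (rightTopology L) := by
  let _ := rightTopology L
  refine ⟨fun x y hxy => ?_⟩
  rcases hxy.lt_or_gt with h | h
  · exact ⟨_, _, isOpen_rightTopology_Ico x y, isOpen_rightTopology_Ici y, ⟨le_rfl, h⟩,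
      Set.self_mem_Ici, Set.disjoint_left.2 fun z hz hz' => hz.2.not_ge hz'⟩
  · exact ⟨_, _, isOpen_rightTopology_Ici x, isOpen_rightTopology_Ico y x, Set.self_mem_Ici,
      ⟨le_rfl, h⟩, Set.disjoint_left.2 fun z hz' hz => hz.2.not_ge hz'⟩

/-- The antidiagonal `{(x, n x)}` is closed, and the quadrant with corner `(x, n x)` meets it only
in that corner, so no quadrant can be dropped from the cover. -/
theorem SquareCompactT2.not_kappaCompact_rightTopology {κ : Cardinal.{u}}
    (h : SquareCompactT2 κ κ) (L : Type u) [LinearOrder L] (hL : #L = κ) (n : L → L)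
    (hn : ∀ x y, x < y → n y < n x) (hnn : ∀ x, n (n x) = x) :
    ¬ @KappaCompact κ L (rightTopology L) := by
  let _ := rightTopology L
  have := t2Space_rightTopology L
  intro hK
  have hw : topWeight L ≤ κ := by
    refine (topWeight_rightTopology_le L).trans ?_
    have : #(WithTop L) ≤ κ := by
      refine (mk_option (α := L)).le.trans ?_
      exact add_le_of_le h.1 hL.le (one_lt_aleph0.le.trans h.1)
    rw [mk_prod, lift_id, lift_id]
    exact (mul_le_mul' hL.le this).trans (mul_eq_self h.1).le
  refine absurd (h.2 L hw hK
    (Set.range (fun x => Set.Ici x ×ˢ Set.Ici (n x)) ∪ {{p | p.2 ≠ n p.1}}) ?_ ?_) ?_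
  · rintro _ (⟨x, rfl⟩ | rfl)
    · exact (isOpen_rightTopology_Ici _).prod (isOpen_rightTopology_Ici _)
    · rw [isOpen_prod_iff]
      intro x y hxy
      rcases (show y ≠ n x from hxy).lt_or_gt with hlt | hlt
      · have hlt' : x < n y := by simpa [hnn] using hn _ _ hlt
        by_cases hz : ∃ z, x < z ∧ z < n y
        · obtain ⟨z, hxz, hzy⟩ := hz
          refine ⟨_, _, isOpen_rightTopology_Ico x z, isOpen_rightTopology_Ico y (n z),
            ⟨le_rfl, hxz⟩, ⟨le_rfl, by simpa [hnn] using hn _ _ hzy⟩, ?_⟩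
          rintro ⟨a, b⟩ ⟨ha, hb⟩ hab
          dsimp only at ha hb hab
          subst hab
          exact (hn _ _ ha.2).not_gt hb.2
        · refine ⟨_, _, isOpen_rightTopology_Ico x (n y), isOpen_rightTopology_Ico y (n x),
            ⟨le_rfl, hlt'⟩, ⟨le_rfl, hlt⟩, ?_⟩
          rintro ⟨a, b⟩ ⟨ha, hb⟩ hab
          dsimp only at ha hb hab
          subst hab
          rcases ha.1.eq_or_lt with rfl | hxa
          · exact hb.2.false
          · exact hz ⟨a, hxa, ha.2⟩
      · refine ⟨_, _, isOpen_rightTopology_Ici x, isOpen_rightTopology_Ici y, le_rfl, le_rfl, ?_⟩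
        rintro ⟨a, b⟩ ⟨ha, hb⟩ hab
        dsimp only at ha hb hab
        subst hab
        rcases (show x ≤ a from ha).eq_or_lt with rfl | hxa
        · exact hlt.not_ge hb
        · exact ((hn _ _ hxa).trans hlt).not_ge hb
  · refine Set.eq_univ_of_forall ?_
    rintro ⟨x, y⟩
    by_cases hy : y = n x
    · exact ⟨_, Or.inl ⟨x, rfl⟩, le_rfl, hy.ge⟩
    · exact ⟨_, Or.inr rfl, hy⟩
  · rintro ⟨V, hVU, hV, hVc⟩
    have hmem : ∀ x, Set.Ici x ×ˢ Set.Ici (n x) ∈ V := by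
      intro x
      have : (x, n x) ∈ ⋃₀ V := hVc ▸ Set.mem_univ _
      obtain ⟨v, hv, hxv⟩ := this
      rcases hVU hv with ⟨y, rfl⟩ | rfl
      · rcases (show y ≤ x from hxv.1).eq_or_lt with rfl | hlt
        · exact hv
        · exact absurd (show n y ≤ n x from hxv.2) (hn _ _ hlt).not_ge
      · exact absurd rfl hxv
    have : #L ≤ #V := by
      refine mk_le_of_injective (f := fun x => (⟨_, hmem x⟩ : V)) fun x y hxy => ?_
      have hxy := congrArg Subtype.val hxy
      dsimp only at hxy
      have h1 : (x, n x) ∈ Set.Ici y ×ˢ Set.Ici (n y) := hxy ▸ ⟨le_rfl, le_rfl⟩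
      have h2 : (y, n y) ∈ Set.Ici x ×ˢ Set.Ici (n x) := hxy ▸ ⟨le_rfl, le_rfl⟩
      exact le_antisymm h2.1 h1.1
    exact (this.trans_lt hV).ne hL

/-! ### Small covers and two criteria for compactness of orders -/

/-- `S` is covered by fewer than `κ` members of `U`. -/
def SmallCover (κ : Cardinal.{u}) {X : Type u} (U : Set (Set X)) (S : Set X) : Prop :=
  ∃ V ⊆ U, #V < κ ∧ S ⊆ ⋃₀ V

theorem SmallCover.mono {κ : Cardinal.{u}} {X : Type u} {U : Set (Set X)} {S S' : Set X}
    (h : SmallCover κ U S) (hS : S' ⊆ S) : SmallCover κ U S' :=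
  let ⟨V, h1, h2, h3⟩ := h
  ⟨V, h1, h2, hS.trans h3⟩

theorem SmallCover.union {κ : Cardinal.{u}} (hκ : ℵ₀ ≤ κ) {X : Type u} {U : Set (Set X)}
    {S S' : Set X} (h : SmallCover κ U S) (h' : SmallCover κ U S') : SmallCover κ U (S ∪ S') := by
  obtain ⟨V, h1, h2, h3⟩ := h
  obtain ⟨V', h1', h2', h3'⟩ := h'
  refine ⟨V ∪ V', Set.union_subset h1 h1', (mk_union_le _ _).trans_lt (add_lt_of_lt hκ h2 h2'), ?_⟩
  rw [Set.sUnion_union]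
  exact Set.union_subset_union h3 h3'

theorem smallCover_of_mem {κ : Cardinal.{u}} (hκ : ℵ₀ ≤ κ) {X : Type u} {U : Set (Set X)}
    {u : Set X} (h : u ∈ U) : SmallCover κ U u :=
  ⟨{u}, by simpa using h, by simpa using one_lt_aleph0.trans_le hκ, by simp⟩

theorem RegularOrder.smallCover_iUnion {κ : Cardinal.{u}} {W : Type u} [LinearOrder W]
    (hW : RegularOrder κ W) {ι X : Type u} (hι : #ι < κ) {U : Set (Set X)} {S : ι → Set X}
    (h : ∀ i, SmallCover κ U (S i)) : SmallCover κ U (⋃ i, S i) := by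
  choose V h1 h2 h3 using h
  refine ⟨⋃ i, V i, Set.iUnion_subset h1, hW.mk_iUnion_lt hι V h2, ?_⟩
  rw [Set.sUnion_iUnion]
  exact Set.iUnion_mono h3

theorem kappaCompact_iff_smallCover {κ : Cardinal.{u}} {X : Type u} [TopologicalSpace X] :
    KappaCompact κ X ↔ ∀ U : Set (Set X), (∀ u ∈ U, IsOpen u) → ⋃₀ U = Set.univ →
      SmallCover κ U Set.univ := by
  simp only [KappaCompact, SmallCover, Set.univ_subset_iff]

theorem lex_bool_lt_iff {W : Type u} [LinearOrder W] {x y : Lex (W → Bool)} :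
    x < y ↔ ∃ i, (∀ j < i, x j = y j) ∧ x i = false ∧ y i = true := by
  have : x < y ↔ ∃ i, (∀ j < i, x j = y j) ∧ x i < y i := Iff.rfl
  simp [this, Bool.lt_iff]

theorem exists_bool_recursion {W : Type u} [LinearOrder W] [WellFoundedLT W]
    (P : W → (W → Bool) → Prop) (hP : ∀ δ f g, (∀ β < δ, f β = g β) → (P δ f ↔ P δ g)) :
    ∃ b : W → Bool, ∀ δ, b δ = true ↔ P δ b := by
  classical
  -- The filler `false` from `δ` on is invisible to `P δ`, by `hP`.
  let F : ∀ δ : W, (∀ β, β < δ → Bool) → Bool :=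
    fun δ g => decide (P δ (fun β => if h : β < δ then g β h else false))
  refine ⟨wellFounded_lt.fix F, fun δ => ?_⟩
  rw [WellFounded.fix_eq]
  simp only [F, decide_eq_true_iff]
  exact hP _ _ _ fun β hβ => by rw [dif_pos hβ]

/-- The paths through the tree `T` of binary sequences (where `T α f` says that the restriction of
`f` to `α` is a node), continued by a constant sequence and ordered lexicographically. -/
abbrev PathOrder {W : Type u} [LinearOrder W] (T : W → (W → Bool) → Prop) : Type u :=
  {f : Lex (W → Bool) // ∃ α, (∀ β < α, T β f) ∧ ∃ i, ∀ β, α ≤ β → f β = i}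

/-- Given a cover with no small subcover, build `b` by turning right exactly when the part to the
left is small. No cone `C α` around `b` is then small, while a cone at a non-node has at most two
points; so `b` would be a branch. -/
theorem RegularOrder.kappaCompact_pathOrder {κ : Cardinal.{u}} (hκ : ℵ₀ ≤ κ) {W : Type u}
    [LinearOrder W] [WellFoundedLT W] (hW : RegularOrder κ W) (T : W → (W → Bool) → Prop)
    (hT : ∀ α f g, (∀ β < α, f β = g β) → T α f → T α g) (hb : ∀ f, ∃ α, ¬ T α f) :
    @KappaCompact κ (PathOrder T) (rightTopology (PathOrder T)) := by
  classical
  let _ := rightTopology (PathOrder T)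
  rw [kappaCompact_iff_smallCover]
  intro U hUo hUc
  by_contra hbad
  have hpt : ∀ x : PathOrder T, ∃ u ∈ U, x ∈ u := fun x =>
    (hUc ▸ Set.mem_univ x : x ∈ ⋃₀ U)
  let D : W → (W → Bool) → Set (PathOrder T) :=
    fun δ f => {x | (∀ β < δ, x.1 β = f β) ∧ x.1 δ = false}
  obtain ⟨b, hbD⟩ := exists_bool_recursion (fun δ f => SmallCover κ U (D δ f)) (by
    intro δ f g hfg
    have : D δ f = D δ g := by
      ext x
      simp +contextual only [D, Set.mem_ofPred_eq, hfg]
    rw [this])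
  let C : W → Set (PathOrder T) := fun α => {x | ∀ β < α, x.1 β = b β}
  have hCT : ∀ α, ¬ SmallCover κ U (C α) → T α b := by
    intro α hα
    by_contra hn
    apply hα
    have hcst : ∀ x ∈ C α, ∃ i, ∀ β, α ≤ β → x.1 β = i := by
      rintro ⟨x, α', h1, i, h2⟩ hx
      refine ⟨i, fun β hβ => h2 β ?_⟩
      by_contra! hlt
      exact hn (hT α x b hx (h1 α (hβ.trans_lt hlt)))
    have hone : ∀ i : Bool, SmallCover κ U {x ∈ C α | ∀ β, α ≤ β → x.1 β = i} := by
      intro i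
      by_cases hne : ∃ x, x ∈ C α ∧ ∀ β, α ≤ β → x.1 β = i
      · obtain ⟨x, hx, hxi⟩ := hne
        obtain ⟨u, hu, hxu⟩ := hpt x
        refine (smallCover_of_mem hκ hu).mono ?_
        rintro y ⟨hy, hyi⟩
        have : y = x := by
          refine Subtype.ext (funext fun β => ?_)
          rcases lt_or_ge β α with h | h
          · exact (hy β h).trans (hx β h).symm
          · exact (hyi β h).trans (hxi β h).symm
        rwa [this]
      · push Not at hne
        refine ⟨∅, by simp, by simpa using aleph0_pos.trans_le hκ, ?_⟩
        rintro x ⟨hx, hxi⟩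
        obtain ⟨β, hβ, h⟩ := hne x hx
        exact absurd (hxi β hβ) h
    refine ((hone true).union hκ (hone false)).mono fun x hx => ?_
    obtain ⟨i, hi⟩ := hcst x hx
    cases i
    · exact Or.inr ⟨hx, hi⟩
    · exact Or.inl ⟨hx, hi⟩
  have hC : ∀ α, ¬ SmallCover κ U (C α) := by
    intro α
    induction α using WellFoundedLT.induction with
    | ind α ih =>
      intro hα
      let f : Lex (W → Bool) := toLex fun β => if β < α then b β else true
      have hflt : ∀ β < α, f β = b β := fun β hβ => if_pos hβ
      have hfge : ∀ β, α ≤ β → f β = true := fun β hβ => if_neg hβ.not_gt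
      -- The largest point of `C α`. A path needs nodes only strictly below `α`, which is exactly
      -- what the induction hypothesis supplies, also at limits.
      let x : PathOrder T := ⟨f, α, fun β hβ => hT β b f
        (fun γ hγ => (hflt γ (hγ.trans hβ)).symm) (hCT β (ih β hβ)), true, hfge⟩
      obtain ⟨u, hu, hxu⟩ := hpt x
      obtain ⟨c, hxc, hc⟩ := hUo u hu x hxu
      have hS : SmallCover κ U
          (u ∪ (C α ∪ ⋃ δ : {δ // δ < α ∧ b δ = true}, D δ.1 b)) := by
        refine (smallCover_of_mem hκ hu).union hκ (hα.union hκ (hW.smallCover_iUnion ?_ ?_))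
        · exact (mk_le_mk_of_subset (s := {δ | δ < α ∧ b δ = true}) (t := Set.Iic α)
            fun δ hδ => hδ.1.le).trans_lt (hW.card_Iic_lt α)
        · exact fun δ => (hbD δ.1).1 δ.2.2
      -- A point below `x` either stays with `b` up to `α` or leaves it to the left at some `δ < α`
      -- with `b δ = true`, into a small set.
      have hmem : ∀ y : PathOrder T, (y : WithTop (PathOrder T)) < c →
          y ∈ u ∪ (C α ∪ ⋃ δ : {δ // δ < α ∧ b δ = true}, D δ.1 b) := by
        intro y hyc
        rcases le_or_gt x y with hxy | hxy
        · exact Or.inl (hc y hxy hyc)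
        · obtain ⟨δ, h1, h2, h3⟩ := lex_bool_lt_iff.1 (show y.1 < f from hxy)
          rcases lt_or_ge δ α with h | h
          · refine Or.inr (Or.inr (Set.mem_iUnion.2 ⟨⟨δ, h, by rw [← hflt δ h, h3]⟩, ?_, h2⟩))
            exact fun β hβ => (h1 β hβ).trans (hflt β (hβ.trans h))
          · exact Or.inr (Or.inl fun β hβ => (h1 β (hβ.trans_le h)).trans (hflt β hβ))
      induction c using WithTop.recTopCoe with
      | top => exact hbad (hS.mono fun y _ => hmem y (WithTop.coe_lt_top y))
      | coe c =>
        obtain ⟨γ, h1, h2, h3⟩ := lex_bool_lt_iff.1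
          (show x.1 < c.1 from (WithTop.coe_lt_coe.1 hxc : x < c))
        have hγ : γ < α := by
          by_contra! h
          exact Bool.false_ne_true (h2.symm.trans (hfge γ h))
        have : b γ ≠ true := fun h =>
          Bool.false_ne_true (h2.symm.trans ((hflt γ hγ).trans h))
        -- Since `c` leaves `b` to the right at `γ`, all of `D γ b` lies below `c` and is small, so
        -- `b` should have turned right there.
        refine this ((hbD γ).2 (hS.mono fun y hy => hmem y (WithTop.coe_lt_coe.2 ?_)))
        refine lex_bool_lt_iff.2 ⟨γ, fun β hβ => ?_, hy.2, h3⟩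
        exact (hy.1 β hβ).trans ((hflt β (hβ.trans hγ)).symm.trans (h1 β hβ))
  obtain ⟨α, hα⟩ := hb b
  exact hα (hCT α (hC α))

/-- This is the proof that the Sorgenfrey line is Lindelöf. Call `x` of type `d` if `u x` contains
`[x, d)`, with `none` for no upper bound. One representative at or below `e` for each pair `(d, e)`
covers all points of type `d` except a possible least one, which `V₂` handles. -/
theorem kappaCompact_rightTopology_of_separating {κ : Cardinal.{u}} (hκ : ℵ₀ ≤ κ) {L : Type u}
    [LinearOrder L] (D : Set L) (hD : #D < κ) (hsep : ∀ x y, x < y → ∃ d ∈ D, x < d ∧ d ≤ y) :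
    @KappaCompact κ L (rightTopology L) := by
  let _ := rightTopology L
  rw [kappaCompact_iff_smallCover]
  intro U hUo hUc
  have hpt : ∀ x : L, ∃ u ∈ U, x ∈ u := fun x => (hUc ▸ Set.mem_univ x : x ∈ ⋃₀ U)
  choose u hu hxu using hpt
  have hsmall : ∀ {I : Type u} (hI : #I < κ) (P : I → L → Prop),
      ∃ V ⊆ U, #V < κ ∧ ∀ i x, P i x → ∃ y, P i y ∧ u y ∈ V := by
    intro I hI P
    refine ⟨Set.range fun i : {i // ∃ x, P i x} => u i.2.choose, ?_, ?_, ?_⟩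
    · rintro _ ⟨i, rfl⟩
      exact hu _
    · exact (mk_range_le.trans (mk_subtype_le _)).trans_lt hI
    · exact fun i x hx => ⟨_, Exists.choose_spec ⟨x, hx⟩, ⟨⟨i, x, hx⟩, rfl⟩⟩
  have hD' : #(Option D) < κ := by
    rw [mk_option]
    exact add_lt_of_lt hκ hD (one_lt_aleph0.trans_le hκ)
  let Below : Option D → L → Prop := fun d x => ∀ e ∈ d, x < e.1
  let A : Option D → L → Prop := fun d x => Below d x ∧ ∀ y, x ≤ y → Below d y → y ∈ u x
  obtain ⟨V₁, hV₁, hc₁, h₁⟩ := hsmall (I := Option D × D) (by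
    rw [mk_prod, lift_id, lift_id]
    exact mul_lt_of_lt hκ hD' hD) (fun p x => A p.1 x ∧ x ≤ p.2.1)
  obtain ⟨V₂, hV₂, hc₂, h₂⟩ := hsmall hD' (fun d x => A d x ∧ ∀ y, A d y → x ≤ y)
  have hV : SmallCover κ U (⋃₀ V₁ ∪ ⋃₀ V₂) :=
    SmallCover.union hκ ⟨V₁, hV₁, hc₁, le_rfl⟩ ⟨V₂, hV₂, hc₂, le_rfl⟩
  refine hV.mono fun z _ => ?_
  obtain ⟨d, hd⟩ : ∃ d, A d z := by
    obtain ⟨c, hzc, hc⟩ := hUo _ (hu z) z (hxu z)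
    induction c using WithTop.recTopCoe with
    | top => exact ⟨none, by simp [Below], fun y hy _ => hc y hy (WithTop.coe_lt_top y)⟩
    | coe c =>
      obtain ⟨d, hd, hzd, hdc⟩ := hsep z c (WithTop.coe_lt_coe.1 hzc)
      exact ⟨some ⟨d, hd⟩, by rintro _ ⟨⟩; exact hzd, fun y hy hyd =>
        hc y hy (WithTop.coe_lt_coe.2 ((hyd _ rfl).trans_le hdc))⟩
  by_cases hm : ∃ x, A d x ∧ x < z
  · obtain ⟨x, hx, hxz⟩ := hm
    obtain ⟨e, he, hxe, hez⟩ := hsep x z hxz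
    obtain ⟨y, ⟨hy, hye⟩, hyV⟩ := h₁ (d, ⟨e, he⟩) x ⟨hx, hxe.le⟩
    exact Or.inl ⟨_, hyV, hy.2 z (hye.trans hez) hd.1⟩
  · push Not at hm
    obtain ⟨y, ⟨hy, hmin⟩, hyV⟩ := h₂ d z ⟨hd, hm⟩
    exact Or.inr ⟨_, hyV, hy.2 z (hmin z hd) hd.1⟩

/-! ### The strong limit property -/

theorem lex_bool_not_lt_not {W : Type u} [LinearOrder W] {x y : Lex (W → Bool)} (h : x < y) :
    (toLex fun β => !y β : Lex (W → Bool)) < toLex fun β => !x β := by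
  obtain ⟨i, h1, h2, h3⟩ := lex_bool_lt_iff.1 h
  exact lex_bool_lt_iff.2 ⟨i, fun j hj => congrArg not (h1 j hj).symm, by
    simp [h3], by simp [h2]⟩

theorem SquareCompactT2.not_kappaCompact_of_lex {κ : Cardinal.{u}} (h : SquareCompactT2 κ κ)
    {W : Type u} [LinearOrder W] [WellFoundedLT W] (P : Lex (W → Bool) → Prop)
    (hP : ∀ f, P f → P (toLex fun β => !f β)) (hc : #{f // P f} = κ) :
    ¬ @KappaCompact κ {f // P f} (rightTopology {f // P f}) :=
  h.not_kappaCompact_rightTopology _ hc (fun f => ⟨toLex fun β => !f.1 β, hP _ f.2⟩)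
    (fun _ _ hxy => lex_bool_not_lt_not hxy)
    (fun x => Subtype.ext (funext fun β => Bool.not_not (x.1 β)))

theorem mk_lex_eventually_const_le {W : Type u} [LinearOrder W] (a : W) :
    #{f : Lex (W → Bool) | ∃ i, ∀ β, a < β → f β = i} ≤ 2 ^ #(Set.Iic a) * 2 := by
  have h2 : #((Set.Iic a → Bool) × ULift.{u} Bool) = 2 ^ #(Set.Iic a) * 2 := by simp
  rw [← h2]
  refine mk_le_of_injective (f := fun f : {f : Lex (W → Bool) | ∃ i, ∀ β, a < β → f β = i} =>
    ((fun β : Set.Iic a => f.1 β.1), ULift.up f.2.choose)) ?_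
  intro f g hfg
  simp only [Prod.mk.injEq, ULift.up.injEq] at hfg
  refine Subtype.ext (funext fun β => ?_)
  rcases le_or_gt β a with hβ | hβ
  · exact congrFun hfg.1 ⟨β, hβ⟩
  · exact (f.2.choose_spec β hβ).trans (hfg.2.trans (g.2.choose_spec β hβ).symm)

/-- For the least `m` with `κ ≤ 2 ^ m`, the eventually constant sequences of length `m` number fewer
than `κ` and separate all sequences. Any `κ` sequences, closed under bit flips and joined with
these, form a forbidden order. -/
theorem SquareCompactT2.two_power_lt {κ : Cardinal.{u}} (h : SquareCompactT2 κ κ) (c : Cardinal.{u})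
    (hc : c < κ) : 2 ^ c < κ := by
  by_contra! hcκ
  let m := sInf {c : Cardinal.{u} | κ ≤ 2 ^ c}
  have hmle : ∀ d, κ ≤ 2 ^ d → m ≤ d := fun d hd =>
    csInf_le' (s := {c : Cardinal.{u} | κ ≤ 2 ^ c}) hd
  have hmκ : κ ≤ 2 ^ m := csInf_mem (s := {c : Cardinal.{u} | κ ≤ 2 ^ c}) ⟨c, hcκ⟩
  have hmin : ∀ d < m, 2 ^ d < κ := fun d hd => not_le.1 fun hle => (hmle d hle).not_gt hd
  have hmlt : m < κ := (hmle c hcκ).trans_lt hc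
  have hm0 : ℵ₀ ≤ m := by
    by_contra! hlt
    exact (hmκ.trans_lt (power_lt_aleph0 (by simp) hlt)).not_ge h.1
  obtain ⟨_, _, hI'⟩ := exists_initial_wellOrder κ.out (by rw [mk_out]; exact h.1)
  have hR := h.regularOrder (mk_out κ) (by simpa using hI')
  obtain ⟨_, _, hI⟩ := exists_initial_wellOrder m.out (by rw [mk_out]; exact hm0)
  let D : Set (Lex (m.out → Bool)) := ⋃ a : m.out, {f | ∃ i, ∀ β, a < β → f β = i}
  have hD : #D < κ := by
    refine hR.mk_iUnion_lt (by rwa [mk_out]) _ fun a => (mk_lex_eventually_const_le a).trans_lt ?_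
    have := hI a
    rw [mk_out] at this
    exact mul_lt_of_lt h.1 (hmin _ this) (ofNat_lt_aleph0.trans_le h.1)
  have hX : κ ≤ #(Lex (m.out → Bool)) := hmκ.trans (by
    rw [show #(Lex (m.out → Bool)) = #(m.out → Bool) from rfl]; simp)
  obtain ⟨X, hX⟩ := le_mk_iff_exists_set.1 hX
  let n : Lex (m.out → Bool) → Lex (m.out → Bool) := fun f => toLex fun β => !f β
  have hnn : ∀ f, n (n f) = f := fun f => funext fun β => Bool.not_not (f β)
  have hnD : ∀ f ∈ D, n f ∈ D := by
    intro f hf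
    obtain ⟨a, i, hi⟩ := Set.mem_iUnion.1 hf
    exact Set.mem_iUnion.2 ⟨a, !i, fun β hβ => congrArg not (hi β hβ)⟩
  let L : Set (Lex (m.out → Bool)) := X ∪ (n '' X ∪ D)
  have hL : #L = κ := by
    refine le_antisymm ?_ (hX ▸ mk_le_mk_of_subset Set.subset_union_left)
    refine (mk_union_le _ _).trans (add_le_of_le h.1 hX.le ((mk_union_le _ _).trans
      (add_le_of_le h.1 (mk_image_le.trans hX.le) hD.le)))
  refine h.not_kappaCompact_of_lex (fun f => f ∈ L) ?_ hL ?_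
  · rintro f (hf | ⟨g, hg, rfl⟩ | hf)
    · exact Or.inr (Or.inl ⟨f, hf, rfl⟩)
    · exact Or.inl (show n (n g) ∈ X by rwa [hnn])
    · exact Or.inr (Or.inr (hnD f hf))
  · refine kappaCompact_rightTopology_of_separating h.1 {f | f.1 ∈ D} ?_ ?_
    · refine lt_of_le_of_lt (mk_le_of_injective
        (f := fun f : {f : {f // f ∈ L} | f.1 ∈ D} => (⟨f.1.1, f.2⟩ : D)) ?_) hD
      intro f g hfg
      exact Subtype.ext (Subtype.ext (congrArg (fun z : D => z.1) hfg))
    · intro x y hxy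
      obtain ⟨i, h1, h2, h3⟩ := lex_bool_lt_iff.1 (show x.1 < y.1 from hxy)
      -- The least sequence that agrees with `x` below `i` and is `true` at `i`.
      let d : Lex (m.out → Bool) := toLex fun β => if β < i then x.1 β else decide (β = i)
      have hd1 : ∀ β < i, d β = x.1 β := fun β hβ => if_pos hβ
      have hd2 : ∀ β, i ≤ β → d β = decide (β = i) := fun β hβ => if_neg hβ.not_gt
      have hdD : d ∈ D := Set.mem_iUnion.2 ⟨i, false, fun β hβ =>
        (hd2 β hβ.le).trans (decide_eq_false hβ.ne')⟩
      refine ⟨⟨d, Or.inr (Or.inr hdD)⟩, hdD, ?_, ?_⟩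
      · exact lex_bool_lt_iff.2 ⟨i, fun j hj => (hd1 j hj).symm, h2,
          (hd2 i le_rfl).trans (decide_eq_true rfl)⟩
      · change d ≤ y.1
        by_contra! hlt
        obtain ⟨j, -, hj2, hj3⟩ := lex_bool_lt_iff.1 hlt
        rcases lt_trichotomy j i with hji | rfl | hji
        · rw [hd1 j hji, h1 j hji, hj2] at hj3
          exact Bool.false_ne_true hj3
        · exact Bool.false_ne_true (hj2.symm.trans h3)
        · rw [hd2 j hji.le, decide_eq_true_iff] at hj3
          exact hji.ne' hj3

/-! ### Branches and homogeneous sets -/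

theorem SquareCompactT2.exists_branch {κ : Cardinal.{u}} (h : SquareCompactT2 κ κ) {W : Type u}
    [LinearOrder W] [WellFoundedLT W] (hW : RegularOrder κ W) (T : W → (W → Bool) → Prop)
    (hT : ∀ α f g, (∀ β < α, f β = g β) → T α f → T α g)
    (hmono : ∀ α β f, α ≤ β → T β f → T α f) (hn : ∀ α f, T α f → T α fun β => !f β)
    (hne : ∀ α, ∃ f, T α f) : ∃ f, ∀ α, T α f := by
  classical
  by_contra! hb
  refine h.not_kappaCompact_of_lex _ ?_ ?_ (hW.kappaCompact_pathOrder h.1 T hT hb)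
  · rintro f ⟨α, h1, i, h2⟩
    exact ⟨α, fun β hβ => hn β f (h1 β hβ), !i, fun β hβ => congrArg not (h2 β hβ)⟩
  · refine le_antisymm ?_ ?_
    · have hsub : {f : Lex (W → Bool) | ∃ α, (∀ β < α, T β f) ∧ ∃ i, ∀ β, α ≤ β → f β = i} ⊆
          ⋃ a : W, {f | ∃ i, ∀ β, a < β → f β = i} := by
        rintro f ⟨α, -, i, hi⟩
        exact Set.mem_iUnion.2 ⟨α, i, fun β hβ => hi β hβ.le⟩
      refine (mk_le_mk_of_subset hsub).trans (mk_iUnion_le_sum_mk.trans ?_)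
      refine (sum_le_sum _ (fun _ => κ) fun a => (mk_lex_eventually_const_le a).trans ?_).trans ?_
      · exact (mul_lt_of_lt h.1 (h.two_power_lt _ (hW.card_Iic_lt a))
          (ofNat_lt_aleph0.trans_le h.1)).le
      · rw [sum_const', hW.card]
        exact (mul_eq_self h.1).le
    -- With fewer than `κ` paths, the levels at which they leave the tree are bounded by some `m`; a
    -- node at level `m`, continued by `true`, is a path that leaves too late.
    · by_contra! hlt
      choose r hr using hb
      obtain ⟨m, hm⟩ := hW.bdd (fun f : PathOrder T => r f.1) hlt
      obtain ⟨g, hg⟩ := hne m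
      let f : Lex (W → Bool) := toLex fun β => if β < m then g β else true
      have hf : T m f := hT m g f (fun β hβ => (if_pos hβ).symm) hg
      exact hr f (hmono _ _ _ (hm ⟨f, m, fun β hβ => hmono _ _ _ hβ.le hf, true,
        fun β hβ => if_neg hβ.not_gt⟩) hf)

/-- In a maximal set whose colours `col x y` are given by `g x`, the colour depends on the smaller
point alone. Such a set is unbounded, since `g` is realised by arbitrarily late `β`, and one value
of `g` occurs unboundedly often in it. -/
theorem RegularOrder.exists_homogeneous_of_branch {κ : Cardinal.{u}} {W : Type u}
    [LinearOrder W] (hW : RegularOrder κ W) (col : W → W → Bool) (g : W → Bool)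
    (hg : ∀ α a, ∃ β, a < β ∧ ∀ ξ < α, g ξ = col ξ β) :
    ∃ H : Set W, #H = κ ∧ ∃ i, ∀ x ∈ H, ∀ y ∈ H, x < y → col x y = i := by
  obtain ⟨M, hM⟩ := zorn_subset {S : Set W | ∀ x ∈ S, ∀ y ∈ S, x < y → g x = col x y} (by
    intro c hc hchain
    refine ⟨⋃₀ c, ?_, fun s hs => Set.subset_sUnion_of_mem hs⟩
    rintro x ⟨s, hs, hx⟩ y ⟨t, ht, hy⟩ hxy
    rcases hchain.total hs ht with hst | hst
    · exact hc ht x (hst hx) y hy hxy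
    · exact hc hs x hx y (hst hy) hxy)
  have hunb : ∀ a, ∃ b ∈ M, a < b := by
    intro a
    by_contra! ha
    obtain ⟨α, hα, -⟩ := hg a a
    obtain ⟨β, hβ, hβc⟩ := hg α a
    have hins : insert β M ⊆ M := hM.2 (by
      rintro x (rfl | hx) y (rfl | hy) hxy
      · exact absurd hxy (lt_irrefl _)
      · exact absurd (hβ.trans hxy) (ha y hy).not_gt
      · exact hβc x ((ha x hx).trans_lt hα)
      · exact hM.1 x hx y hy hxy) (Set.subset_insert _ _)
    exact (ha β (hins (Set.mem_insert _ _))).not_gt hβ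
  obtain ⟨i, hi⟩ : ∃ i, ∀ a, ∃ b ∈ {x ∈ M | g x = i}, a < b := by
    by_contra! hc
    obtain ⟨a, ha⟩ := hc true
    obtain ⟨b, hb⟩ := hc false
    obtain ⟨x, hx, hlt⟩ := hunb (max a b)
    cases hgx : g x
    · exact (hb x ⟨hx, hgx⟩).not_gt ((le_max_right _ _).trans_lt hlt)
    · exact (ha x ⟨hx, hgx⟩).not_gt ((le_max_left _ _).trans_lt hlt)
  exact ⟨_, hW.mk_eq_of_unbounded hi, i, fun x hx y hy hxy => by
    rw [← hM.1 x hx.1 y hy.1 hxy, hx.2]⟩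

theorem SquareCompactT2.exists_homogeneous {κ : Cardinal.{u}} (h : SquareCompactT2 κ κ)
    {W : Type u} [LinearOrder W] [WellFoundedLT W] (hW : RegularOrder κ W) (col : W → W → Bool) :
    ∃ H : Set W, #H = κ ∧ ∃ i, ∀ x ∈ H, ∀ y ∈ H, x < y → col x y = i := by
  let N : W → (W → Bool) → Prop := fun α f => ∀ a, ∃ β, a < β ∧ ∀ ξ < α, f ξ = col ξ β
  have hNmono : ∀ α β f, α ≤ β → N β f → N α f := by
    intro α β f hαβ hf a
    obtain ⟨γ, hγ, hc⟩ := hf a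
    exact ⟨γ, hγ, fun ξ hξ => hc ξ (hξ.trans_le hαβ)⟩
  have hNcongr : ∀ α f g, (∀ β < α, f β = g β) → N α f → N α g := by
    intro α f g hfg hf a
    obtain ⟨γ, hγ, hc⟩ := hf a
    exact ⟨γ, hγ, fun ξ hξ => (hfg ξ hξ).symm.trans (hc ξ hξ)⟩
  have hne : ∀ α, ∃ f, N α f := by
    classical
    intro α
    by_contra! hc
    simp only [N] at hc
    push Not at hc
    choose a ha using hc
    -- There are fewer than `κ` patterns on `Iic α`. If each had a bound on its realisations, a
    -- point beyond all the bounds would realise no pattern, not even its own.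
    obtain ⟨m, hm⟩ := hW.bdd (fun s : Set.Iic α → Bool =>
      a fun ξ => if hξ : ξ ≤ α then s ⟨ξ, hξ⟩ else false) (by
        simpa using h.two_power_lt _ (hW.card_Iic_lt α))
    obtain ⟨β, -, hβ⟩ := exists_gt_of_mk_eq hW.card_Iic_lt (mk_univ.trans hW.card) m
    obtain ⟨ξ, hξ, hn⟩ := ha _ β ((hm fun ξ => col ξ.1 β).trans_lt hβ)
    exact hn (dif_pos hξ.le)
  -- The tree of patterns need not be closed under bit flips, so flipped patterns are added. A
  -- branch of the enlarged tree, or its flip, is a branch of the original one.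
  obtain ⟨f, hf⟩ := h.exists_branch hW (fun α f => N α f ∨ N α fun β => !f β)
    (fun α f g hfg => Or.imp (hNcongr α _ _ hfg)
      (hNcongr α _ _ fun β hβ => congrArg not (hfg β hβ)))
    (fun α β f hαβ => Or.imp (hNmono α β _ hαβ) (hNmono α β _ hαβ))
    (fun α f hf => by simpa using hf.symm)
    (fun α => (hne α).imp fun f hf => Or.inl hf)
  obtain ⟨g, hg⟩ : ∃ g, ∀ α, N α g := by
    by_cases h1 : ∀ α, N α f
    · exact ⟨f, h1⟩
    · push Not at h1
      obtain ⟨α, hα⟩ := h1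
      refine ⟨fun ξ => !f ξ, fun β => ?_⟩
      rcases hf (max α β) with hm | hm
      · exact absurd (hNmono _ _ _ (le_max_left _ _) hm) hα
      · exact hNmono _ _ _ (le_max_right _ _) hm
  exact hW.exists_homogeneous_of_branch col g hg

theorem SquareCompactT2.weaklyCompact {κ : Cardinal.{u}} (hκ : ℵ₀ < κ) (h : SquareCompactT2 κ κ) :
    WeaklyCompact κ := by
  classical
  refine ⟨hκ, fun A hA c => ?_⟩
  obtain ⟨_, _, hI⟩ := exists_initial_wellOrder A (hA ▸ hκ.le)
  have hW := h.regularOrder hA (hA ▸ hI)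
  obtain ⟨H, hH, i, hi⟩ := h.exists_homogeneous hW
    (fun x y => if hxy : x ≠ y then c ⟨{x, y}, Finset.card_pair hxy⟩ else false)
  refine ⟨H, hH, i, ?_⟩
  have key : ∀ x ∈ H, ∀ y ∈ H, ∀ hxy : x ≠ y, x < y → c ⟨{x, y}, Finset.card_pair hxy⟩ = i :=
    fun x hx y hy hxy hlt => by simpa [hxy] using hi x hx y hy hlt
  rintro ⟨s, hs⟩ hsH
  obtain ⟨x, y, hxy, rfl⟩ := Finset.card_eq_two.1 hs
  have hx : x ∈ H := hsH (by simp)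
  have hy : y ∈ H := hsH (by simp)
  rcases hxy.lt_or_gt with hlt | hlt
  · exact key x hx y hy hxy hlt
  · rw [← key y hy x hx hxy.symm hlt]
    exact congrArg c (Subtype.ext (Finset.pair_comm x y))

theorem SquareCompact.squareCompactT2 {μ κ : Cardinal.{u}} (h : SquareCompact μ κ) :
    SquareCompactT2 μ κ :=
  ⟨h.1, fun X _ _ => h.2 X⟩

theorem theorem15 (κ : Cardinal.{u}) (hκ : ℵ₀ < κ) :
    (WeaklyCompact κ ↔ SquareCompact κ κ) ∧ (WeaklyCompact κ ↔ SquareCompactT2 κ κ) :=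
  ⟨⟨fun h => h.squareCompact, fun h => h.squareCompactT2.weaklyCompact hκ⟩,
    ⟨fun h => h.squareCompact.squareCompactT2, fun h => h.weaklyCompact hκ⟩⟩
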